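/- Let $I=\mathbb R/\mathbb Z$ with $\partial I=\emptyset$, or $I=(0,1)$ with $\partial I=\{0,1\}$, and let $\partial I=\partial_D I\cup\partial_0 I\cup\partial_1 I\cup\partial_2 I$ be a disjoint partitioning. Let $J\ge 3$, $h=1/J$, $q_j=jh$. Let $V^h$ be the space of continuous functions on $\overline I$ that are linear on each $[q_{j-1},q_j]$, $j=1,\dots,J$ (with $q_0$ and $q_J$ identified if $I=\mathbb R/\mathbb Z$), and let $\underline V^h=[V^h]^2$. Let $\underline V^h_\partial$ be the set of $\vec\eta\in\underline V^h$ with $\vec\eta\cdot\vec e_1=0$ on $\partial_0 I$, $\vec\eta\cdot\vec e_i=0$ on $\partial_i I$ for $i=1,2$, and $\vec\eta=\vec 0$ on $\partial_D I$. Let $(\cdot,\cdot)$ be the $L^2$-inner product on $I$ and $$(f,g)^h=\tfrac12 h\sum_{j=1}^J\big[(f\cdot g)(q_j^-)+(f\cdot g)(q_{j-1}^+)\big]$$ the mass lumped inner product of piecewise continuous functions, where $q^\pm$ denote one-sided limits. Write $(\cdot,\cdot)^{(h)}$ for either one of these two, the same choice at every occurrence. Let $\underline W^h_{(\partial_0)}$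 be $\underline V^h$ for the choice $(\cdot,\cdot)$, and the set of elements of $\underline V^h$ vanishing on $\partial_0 I$ for the choice $(\cdot,\cdot)^h$. Let $\widehat\varrho^{(p)}\in\mathbb R$, $p\in\{0,1\}$, be given, let $[r]_\pm=\pm\max\{\pm r,0\}$, and let $\Delta t_m>0$. Suppose that $\partial_0 I=\emptyset$ and that $\vec X^m\in\underline V^h$ satisfies $|\vec X^m_\rho|>0$ almost everywhere on $I$ and $\vec X^m\cdot\vec e_1>0$ on $\overline I\setminus\partial_0 I$. If $$\Delta t_m<3\,\min_{\overline I}(\vec X^m\cdot\vec e_1)^2,$$ then, for each of the two choices of $(\cdot,\cdot)^{(h)}$, there exist $\delta\vec X^{m+1}\in\underline V^h_\partial$ and $\vec\kappa_{\mathcal S}^{m+1}\in\underline W^h_{(\partial_0)}$ such that, with $\vec X^{m+1}=\vec X^m+\delta\vec X^{m+1}$, $$\Big(\vec X^m\cdot\vec e_1\,\tfrac{\vec X^{m+1}-\vec X^m}{\Delta t_m},\vec\chi\,|\vec X^m_\rho|\Big)^{(h)}=\Big((\vec X^m\cdot\vec e_1)\,\vec\kappa_{\mathcal S}^{m+1},\vec\chi\,|\vec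 X^m_\rho|\Big)^{(h)}\qquad\forall\,\vec\chi\in\underline W^h_{(\partial_0)},$$ and, for all $\vec\eta\in\underline V^h_\partial$, $$\begin{aligned}&\Big((\vec X^m\cdot\vec e_1)\,\vec\kappa_{\mathcal S}^{m+1},\vec\eta\,|\vec X^m_\rho|\Big)^{(h)}+\big(\vec\eta\cdot\vec e_1,|\vec X^{m+1}_\rho|\big)+\big((\vec X^m\cdot\vec e_1)\,\vec X^{m+1}_\rho,\vec\eta_\rho\,|\vec X^m_\rho|^{-1}\big)\\&\quad=-\sum_{p\in\partial_1 I}\widehat\varrho^{(p)}(\vec X^m(p)\cdot\vec e_1)\,\vec\eta(p)\cdot\vec e_2-\sum_{p\in\partial_2 I}\Big(\big([\widehat\varrho^{(p)}]_+\vec X^{m+1}(p)+[\widehat\varrho^{(p)}]_-\vec X^m(p)\big)\cdot\vec e_1\Big)\,\vec\eta(p)\cdot\vec e_1.\end{aligned}$$ -/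

import Mathlib

open Set MeasureTheory

noncomputable section

namespace AxiMCF

/-- The Euclidean plane; coordinate `0` is the component along `e₁`, coordinate `1` the one
along `e₂`. -/
abbrev Plane : Type := EuclideanSpace ℝ (Fin 2)

/-- The parameter domain `I`: the periodic interval `ℝ / ℤ` or the open interval `(0, 1)`.
In both cases functions on the closure of `I` are given as functions of a real variable of which
only the values on `[0, 1]` matter; in the periodic case the values at `0` and `1` agree. -/
inductive ParamDomain where
  | periodic
  | unitInterval

/-- The boundary of the parameter domain: empty, respectively `{0, 1}`. -/
def ParamDomain.boundary : ParamDomain → Finset ℝ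
  | .periodic => ∅
  | .unitInterval => {0, 1}

/-- A disjoint partitioning of the boundary of `I` into `∂₀I` (end points on the axis of
rotation), `∂₁I` (movement only along `e₂`), `∂₂I` (movement only along `e₁`) and `∂_D I`
(fixed end points). -/
structure BoundaryPartition (I : ParamDomain) where
  bd0 : Finset ℝ
  bd1 : Finset ℝ
  bd2 : Finset ℝ
  bdD : Finset ℝ
  union_eq : bdD ∪ bd0 ∪ bd1 ∪ bd2 = I.boundary
  disjoint_D0 : Disjoint bdD bd0
  disjoint_D1 : Disjoint bdD bd1
  disjoint_D2 : Disjoint bdD bd2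
  disjoint_01 : Disjoint bd0 bd1
  disjoint_02 : Disjoint bd0 bd2
  disjoint_12 : Disjoint bd1 bd2

/-- The nodes `q_j = j h`, where `h = 1 / J`, of the equipartition of `[0, 1]` into `J` elements. -/
def node (J j : ℕ) : ℝ := (j : ℝ) * (J : ℝ)⁻¹

/-- The space `V^h` of continuous functions on the closure of `I` that are linear on every element
`[q_j, q_{j+1}]`, `j = 0, …, J - 1`. -/
def Vh (I : ParamDomain) (J : ℕ) : Set (ℝ → ℝ) :=
  {f | ContinuousOn f (Icc 0 1) ∧ (I = .periodic → f 0 = f 1) ∧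
    ∀ j < J, ∃ a b : ℝ, ∀ ρ ∈ Icc (node J j) (node J (j + 1)), f ρ = a * ρ + b}

/-- The space `[V^h]²`, componentwise. -/
def VhVec (I : ParamDomain) (J : ℕ) : Set (ℝ → Plane) :=
  {η | ∀ i : Fin 2, (fun ρ => η ρ i) ∈ Vh I J}

/-- The elements of `[V^h]²` whose `e₁`-component vanishes on `∂₀I`. -/
def VhVecAxis {I : ParamDomain} (P : BoundaryPartition I) (J : ℕ) : Set (ℝ → Plane) :=
  {η | η ∈ VhVec I J ∧ ∀ p ∈ P.bd0, η p 0 = 0}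

/-- The space of admissible variations: elements of `[V^h]²` with `η · e₁ = 0` on `∂₀I`,
`η · e_i = 0` on `∂_iI` for `i = 1, 2`, and `η = 0` on `∂_D I`. -/
def VhVecBdry {I : ParamDomain} (P : BoundaryPartition I) (J : ℕ) : Set (ℝ → Plane) :=
  {η | η ∈ VhVecAxis P J ∧ (∀ p ∈ P.bd1, η p 0 = 0) ∧ (∀ p ∈ P.bd2, η p 1 = 0) ∧
    ∀ p ∈ P.bdD, η p = 0}

/-- The space `W^h_{∂₀}` of scalar finite element functions vanishing on `∂₀I`. -/
def WhAxis {I : ParamDomain} (P : BoundaryPartition I) (J : ℕ) : Set (ℝ → ℝ) :=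
  {χ | χ ∈ Vh I J ∧ ∀ p ∈ P.bd0, χ p = 0}

/-- The two versions of the scheme: with true integration or with mass lumping. -/
inductive Quadrature where
  | exact
  | lumped

/-- The space for the discrete curvature vector: `[V^h]²` with true integration and
`[W^h_{∂₀}]²` with mass lumping. -/
def WhVec (Q : Quadrature) {I : ParamDomain} (P : BoundaryPartition I) (J : ℕ) :
    Set (ℝ → Plane) :=
  match Q with
  | .exact => VhVec I J
  | .lumped => {χ | ∀ i : Fin 2, (fun ρ => χ ρ i) ∈ WhAxis P J}

section InnerProducts

variable {E : Type*} [NormedAddCommGroup E] [InnerProductSpace ℝ E]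

/-- The `L²`-inner product on `I`, for scalar (`E = ℝ`) and vector valued functions. -/
def l2Inner (f g : ℝ → E) : ℝ := ∫ ρ in (0 : ℝ)..1, inner ℝ (f ρ) (g ρ)

/-- The mass lumped inner product
`½ h ∑_j ((f · g)(q_{j+1}⁻) + (f · g)(q_j⁺))`, sum over `j = 0, …, J - 1`,
of functions that are piecewise continuous with respect to the partition. -/
def lumpedInner (J : ℕ) (f g : ℝ → E) : ℝ :=
  1 / 2 * (J : ℝ)⁻¹ * ∑ j ∈ Finset.range J,
    (Function.leftLim (fun ρ => inner ℝ (f ρ) (g ρ)) (node J (j + 1)) +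
      Function.rightLim (fun ρ => inner ℝ (f ρ) (g ρ)) (node J j))

/-- The `L²`-inner product or its mass lumped version. -/
def quadInner (Q : Quadrature) (J : ℕ) (f g : ℝ → E) : ℝ :=
  match Q with
  | .exact => l2Inner f g
  | .lumped => lumpedInner J f g

end InnerProducts

/-- The assumption `(𝔄)`: `|X_ρ| > 0` almost everywhere on `I`, and `X · e₁ > 0` on the closure of
`I` except on `∂₀I`. -/
def AssumptionA {I : ParamDomain} (P : BoundaryPartition I) (X : ℝ → Plane) : Prop :=
  (∀ᵐ ρ ∂(volume.restrict (Ioo (0 : ℝ) 1)), 0 < ‖deriv X ρ‖) ∧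
    ∀ ρ ∈ Icc (0 : ℝ) 1, ρ ∉ P.bd0 → 0 < X ρ 0

/-- `[r]₊ = max {r, 0}`. -/
def posPart (r : ℝ) : ℝ := max r 0

/-- `[r]₋ = - max {- r, 0}`, so that `r = [r]₊ + [r]₋`. -/
def negPart (r : ℝ) : ℝ := -max (-r) 0

/-- `(δX, κ)` solves one time step, of length `dt` and starting from `X = X^m`, of the nonlinear
scheme `(𝒟_{m,⋆})` (for `Q = exact`) or `(𝒟_{m,⋆})^h` (for `Q = lumped`). Here `X + δX = X^{m+1}`
and `κ` is the discrete curvature vector; `c p` is the contact energy density at the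
end point `p`. -/
def IsSolutionDStar (Q : Quadrature) {I : ParamDomain} (P : BoundaryPartition I) (J : ℕ)
    (c : ℝ → ℝ) (dt : ℝ) (X δX κ : ℝ → Plane) : Prop :=
  δX ∈ VhVecBdry P J ∧ κ ∈ WhVec Q P J ∧
  (∀ χ ∈ WhVec Q P J,
    quadInner Q J (fun ρ => X ρ 0 • dt⁻¹ • ((X + δX) ρ - X ρ)) (fun ρ => ‖deriv X ρ‖ • χ ρ) =
      quadInner Q J (fun ρ => X ρ 0 • κ ρ) (fun ρ => ‖deriv X ρ‖ • χ ρ)) ∧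
  (∀ η ∈ VhVecBdry P J,
    quadInner Q J (fun ρ => X ρ 0 • κ ρ) (fun ρ => ‖deriv X ρ‖ • η ρ) +
      l2Inner (fun ρ => η ρ 0) (fun ρ => ‖deriv (X + δX) ρ‖) +
      l2Inner (fun ρ => X ρ 0 • deriv (X + δX) ρ) (fun ρ => ‖deriv X ρ‖⁻¹ • deriv η ρ) =
    -(∑ p ∈ P.bd1, c p * X p 0 * η p 1) -
      ∑ p ∈ P.bd2, (posPart (c p) * (X + δX) p 0 + negPart (c p) * X p 0) * η p 0)

end AxiMCF

end

noncomputable section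

namespace AxiMCF


/-! Since `∂₀I` is empty, both choices of the curvature space equal `[V^h]²`, so `κ = δX / dt` is
admissible and satisfies the first equation pointwise. What remains is one finite-dimensional
equation for `u = δX`: a bilinear form (mass, stiffness, implicit contact energy), plus a load, plus
the nonlinear length term, which is a sum over elements of the mean of `v · e₁` times the norm of
the jump of `X + u`.

The norm is 1-Lipschitz, so the operator is Lipschitz, and it is strongly monotone as soon as the
bilinear form strictly dominates the sum of `|mean of w · e₁|` times `‖jump of w‖`. This is checked
element by element (`element_coercive`): the mass term controls the squared midpoint value, the
stiffness term the squared jump, and Young's inequality closes the estimate when `dt < 4 m²`, with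
`m` the minimum of `X · e₁`; the assumed bound with factor 3 is stronger. Zarantonello's theorem
then gives a solution, through `exists_bilin_add_sum_norm_eq_zero`. The lemmas on elements convert
integrals and lumped sums into the nodal values used there. -/

/-! ### Abstract solvability by strong monotonicity -/

/-- Zarantonello's theorem: a Lipschitz continuous, strongly monotone operator on a Hilbert space
has a zero. -/
theorem exists_zero_of_lipschitz_of_strongly_monotone {E : Type*} [NormedAddCommGroup E]
    [InnerProductSpace ℝ E] [CompleteSpace E] {F : E → E} {K : NNReal} (hF : LipschitzWith K F)
    {α : ℝ} (hα : 0 < α) (hmono : ∀ u v, α * ‖u - v‖ ^ 2 ≤ inner ℝ (F u - F v) (u - v)) :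
    ∃ u, F u = 0 := by
  have hK : (0 : ℝ) ≤ K := K.2
  -- Adding `α` to `K` makes `L` positive even if `K = 0`, and gives `α ≤ L`. With `t = α / L²` the
  -- squared contraction factor `1 - 2tα + t²L²` equals `1 - tα`, which lies in `[0, 1)`.
  set L : ℝ := K + α with hL
  have hL0 : 0 < L := by positivity
  set t : ℝ := α / L ^ 2 with ht
  have ht0 : 0 < t := by positivity
  have htL : t * L ^ 2 = α := by rw [ht]; field_simp
  have htα : t * α ≤ 1 := by
    rw [ht, div_mul_eq_mul_div, div_le_one (by positivity)]
    nlinarith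
  have hk1 : Real.sqrt (1 - t * α) < 1 := by
    rw [Real.sqrt_lt' one_pos]
    have := mul_pos ht0 hα
    linarith
  set k : NNReal := ⟨Real.sqrt (1 - t * α), Real.sqrt_nonneg _⟩ with hk
  have hT : ContractingWith k (fun u => u - t • F u) := by
    refine ⟨by rw [← NNReal.coe_lt_coe]; exact hk1, LipschitzWith.of_dist_le_mul fun u v => ?_⟩
    rw [dist_eq_norm, dist_eq_norm]
    have e : u - t • F u - (v - t • F v) = (u - v) - t • (F u - F v) := by
      rw [smul_sub]; abel
    have hlip : ‖F u - F v‖ ≤ K * ‖u - v‖ := by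
      simpa [dist_eq_norm] using hF.dist_le_mul u v
    have hsq : ‖F u - F v‖ ^ 2 ≤ L ^ 2 * ‖u - v‖ ^ 2 := by
      rw [← mul_pow]
      refine pow_le_pow_left₀ (norm_nonneg _) (hlip.trans ?_) 2
      exact mul_le_mul_of_nonneg_right (by rw [hL]; linarith) (norm_nonneg _)
    change _ ≤ Real.sqrt (1 - t * α) * _
    refine le_of_sq_le_sq ?_ (by positivity)
    rw [mul_pow, Real.sq_sqrt (by linarith), e, norm_sub_sq_real, norm_smul, inner_smul_right,
      real_inner_comm, mul_pow, Real.norm_eq_abs, sq_abs]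
    have h1 := mul_le_mul_of_nonneg_left (hmono u v) ht0.le
    have h2 := mul_le_mul_of_nonneg_left hsq (sq_nonneg t)
    have h3 : t ^ 2 * (L ^ 2 * ‖u - v‖ ^ 2) = t * α * ‖u - v‖ ^ 2 := by rw [← htL]; ring
    nlinarith
  refine ⟨hT.fixedPoint, ?_⟩
  have hfix : hT.fixedPoint - t • F hT.fixedPoint = hT.fixedPoint := hT.fixedPoint_isFixedPt
  rw [sub_eq_self, smul_eq_zero] at hfix
  exact hfix.resolve_left ht0.ne'

/-- Solvability of a finite-dimensional variational problem whose nonlinearity is a sum of norms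
controlled by the bilinear form, in an inner product space. -/
theorem exists_bilin_add_sum_norm_eq_zero_of_inner {E G ι : Type*} [NormedAddCommGroup E]
    [InnerProductSpace ℝ E] [FiniteDimensional ℝ E] [NormedAddCommGroup G] [NormedSpace ℝ G]
    (s : Finset ι) (A : E →ₗ[ℝ] E →ₗ[ℝ] ℝ) (φ : ι → E →ₗ[ℝ] ℝ) (D : ι → E →ₗ[ℝ] G)
    (d : ι → G) (ℓ : E →ₗ[ℝ] ℝ)
    (hA : ∀ w, w ≠ 0 → ∑ i ∈ s, |φ i w| * ‖D i w‖ < A w w) :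
    ∃ u, ∀ v, A u v + ∑ i ∈ s, φ i v * ‖d i + D i u‖ + ℓ v = 0 := by
  have : CompleteSpace E := FiniteDimensional.complete ℝ E
  -- The Riesz map turns the variational equation into `F u = 0`.
  let R : (E →ₗ[ℝ] ℝ) →ₗ[ℝ] E :=
    (InnerProductSpace.toDual ℝ E).symm.toLinearEquiv.toLinearMap ∘ₗ
      (LinearMap.toContinuousLinearMap (𝕜 := ℝ) (E := E) (F' := ℝ)).toLinearMap
  have hR : ∀ f v, inner ℝ (R f) v = f v := fun f v => by simp [R]
  let F : E → E := fun u => R (A u) + ∑ i ∈ s, ‖d i + D i u‖ • R (φ i) + R ℓ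
  have hdiff : ∀ u v, F u - F v =
      R (A (u - v)) + ∑ i ∈ s, (‖d i + D i u‖ - ‖d i + D i v‖) • R (φ i) := by
    intro u v
    simp only [F, map_sub, sub_smul, Finset.sum_sub_distrib]
    abel
  have hnorm : ∀ i u v, |‖d i + D i u‖ - ‖d i + D i v‖| ≤ ‖D i (u - v)‖ := by
    intro i u v
    refine (abs_norm_sub_norm_le _ _).trans_eq ?_
    rw [map_sub]; congr 1; abel
  let RA : E →L[ℝ] E := LinearMap.toContinuousLinearMap (R ∘ₗ A)
  let D' : ι → E →L[ℝ] G := fun i => LinearMap.toContinuousLinearMap (D i)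
  have hlip : LipschitzWith (Real.toNNReal (‖RA‖ + ∑ i ∈ s, ‖D' i‖ * ‖R (φ i)‖)) F := by
    refine LipschitzWith.of_dist_le' fun u v => ?_
    rw [dist_eq_norm, dist_eq_norm, hdiff, add_mul, Finset.sum_mul]
    refine (norm_add_le _ _).trans (add_le_add (RA.le_opNorm (u - v)) ?_)
    refine norm_sum_le_of_le _ fun i _ => ?_
    rw [norm_smul, Real.norm_eq_abs, mul_right_comm]
    exact mul_le_mul_of_nonneg_right ((hnorm i u v).trans ((D' i).le_opNorm (u - v)))
      (norm_nonneg _)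
  let g : E → ℝ := fun w => A w w - ∑ i ∈ s, |φ i w| * ‖D i w‖
  have hg : Continuous g := by
    have h1 : Continuous fun w => A w w := by
      have : (fun w => A w w) = fun w => inner ℝ (RA w) w := by
        ext w; exact (hR _ _).symm
      rw [this]
      exact RA.continuous.inner continuous_id
    refine h1.sub (continuous_finsetSum _ fun i _ => ?_)
    exact (LinearMap.continuous_of_finiteDimensional (φ i)).abs.mul
      (LinearMap.continuous_of_finiteDimensional (D i)).norm
  -- `g` is homogeneous of degree two and positive off the origin, so its minimum on the compact
  -- unit sphere is a coercivity constant. An empty sphere means that the space is trivial.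
  obtain ⟨α, hα, hcoer⟩ : ∃ α > 0, ∀ w, α * ‖w‖ ^ 2 ≤ g w := by
    rcases (Metric.sphere (0 : E) 1).eq_empty_or_nonempty with hE | hE
    · refine ⟨1, one_pos, fun w => ?_⟩
      have : w = 0 := by
        by_contra hw
        have : ‖w‖⁻¹ • w ∈ Metric.sphere (0 : E) 1 := by
          simp [norm_smul, norm_ne_zero_iff.2 hw]
        rw [hE] at this
        exact this
      simp [this, g]
    · obtain ⟨w₀, hw₀, hmin⟩ := (isCompact_sphere (0 : E) 1).exists_isMinOn hE hg.continuousOn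
      refine ⟨g w₀, sub_pos.2 (hA w₀ (ne_zero_of_mem_unit_sphere ⟨w₀, hw₀⟩)), fun w => ?_⟩
      rcases eq_or_ne w 0 with rfl | hw
      · simp [g]
      have hw' : ‖w‖ ≠ 0 := norm_ne_zero_iff.2 hw
      have h1 : g w₀ ≤ g (‖w‖⁻¹ • w) := hmin (by simp [norm_smul, hw'])
      have h2 : g (‖w‖⁻¹ • w) = (‖w‖⁻¹) ^ 2 * g w := by
        simp only [g, map_smul, LinearMap.smul_apply, smul_eq_mul, abs_mul, norm_smul,
          Real.norm_eq_abs, mul_sub, Finset.mul_sum]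
        congr 1
        · ring
        · refine Finset.sum_congr rfl fun i _ => ?_
          rw [abs_of_nonneg (inv_nonneg.2 (norm_nonneg w))]
          ring
      rw [h2] at h1
      calc g w₀ * ‖w‖ ^ 2 ≤ (‖w‖⁻¹) ^ 2 * g w * ‖w‖ ^ 2 :=
            mul_le_mul_of_nonneg_right h1 (sq_nonneg _)
        _ = g w := by field_simp
  obtain ⟨u, hu⟩ := exists_zero_of_lipschitz_of_strongly_monotone hlip hα fun u v => by
    refine (hcoer (u - v)).trans ?_
    rw [hdiff, inner_add_left, hR, sum_inner]
    change A (u - v) (u - v) - _ ≤ _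
    rw [sub_eq_add_neg (A (u - v) (u - v)), ← Finset.sum_neg_distrib]
    refine add_le_add le_rfl (Finset.sum_le_sum fun i _ => ?_)
    rw [real_inner_smul_left, hR]
    refine neg_le_of_abs_le ?_
    rw [abs_mul, mul_comm]
    exact mul_le_mul_of_nonneg_left (hnorm i u v) (abs_nonneg _)
  refine ⟨u, fun v => ?_⟩
  have h := congrArg (fun x => inner ℝ x v) hu
  simp only [F, inner_add_left, hR, sum_inner, real_inner_smul_left, inner_zero_left] at h
  simpa only [mul_comm] using h

/-- Solvability of a finite-dimensional variational problem whose nonlinearity is a sum of norms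
controlled by the bilinear form. -/
theorem exists_bilin_add_sum_norm_eq_zero {E G ι : Type*} [AddCommGroup E]
    [Module ℝ E] [FiniteDimensional ℝ E] [NormedAddCommGroup G] [NormedSpace ℝ G]
    (s : Finset ι) (A : E →ₗ[ℝ] E →ₗ[ℝ] ℝ) (φ : ι → E →ₗ[ℝ] ℝ) (D : ι → E →ₗ[ℝ] G)
    (d : ι → G) (ℓ : E →ₗ[ℝ] ℝ)
    (hA : ∀ w, w ≠ 0 → ∑ i ∈ s, |φ i w| * ‖D i w‖ < A w w) :
    ∃ u, ∀ v, A u v + ∑ i ∈ s, φ i v * ‖d i + D i u‖ + ℓ v = 0 := by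
  -- The domination hypothesis involves no norm on `E`, so any Euclidean structure may be imposed.
  let e : E ≃ₗ[ℝ] EuclideanSpace ℝ (Fin (Module.finrank ℝ E)) :=
    (Module.finBasis ℝ E).equivFun.trans (WithLp.linearEquiv 2 ℝ _).symm
  obtain ⟨u, hu⟩ := exists_bilin_add_sum_norm_eq_zero_of_inner s
    (A.compl₁₂ e.symm.toLinearMap e.symm.toLinearMap) (fun i => φ i ∘ₗ e.symm.toLinearMap)
    (fun i => D i ∘ₗ e.symm.toLinearMap) d (ℓ ∘ₗ e.symm.toLinearMap)
    (fun w hw => hA (e.symm w) (by simpa using hw))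
  refine ⟨e.symm u, fun v => ?_⟩
  simpa using hu (e v)


/-! ### The equipartition -/

section Nodes

variable {J : ℕ}

theorem node_zero : node J 0 = 0 := by simp [node]

theorem node_self (hJ : 0 < J) : node J J = 1 := by
  have : (J : ℝ) ≠ 0 := by positivity
  simp [node, this]

theorem mul_node (hJ : 0 < J) (k : ℕ) : (J : ℝ) * node J k = k := by
  have : (J : ℝ) ≠ 0 := by positivity
  simp only [node]; field_simp

theorem node_lt_node_succ (hJ : 0 < J) (k : ℕ) : node J k < node J (k + 1) := by
  have : (0 : ℝ) < (J : ℝ)⁻¹ := by positivity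
  simp only [node]; push_cast; nlinarith

theorem node_mem_Icc (hJ : 0 < J) {k : ℕ} (hk : k ≤ J) : node J k ∈ Icc (0 : ℝ) 1 := by
  have hJ' : (0 : ℝ) < J := by positivity
  have hk' : (k : ℝ) ≤ J := by exact_mod_cast hk
  refine ⟨by simp only [node]; positivity, ?_⟩
  rw [node, ← div_eq_mul_inv, div_le_one hJ']
  exact hk'

theorem mem_Icc_node_iff (hJ : 0 < J) {k : ℕ} {ρ : ℝ} :
    ρ ∈ Icc (node J k) (node J (k + 1)) ↔ (k : ℝ) ≤ J * ρ ∧ (J : ℝ) * ρ ≤ k + 1 := by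
  have hJ' : (0 : ℝ) < J := by positivity
  rw [mem_Icc, ← mul_le_mul_iff_right₀ (b := node J k) hJ', mul_node hJ,
    ← mul_le_mul_iff_right₀ (c := node J (k + 1)) hJ', mul_node hJ]
  push_cast; rfl

theorem exists_mem_Icc_node (hJ : 0 < J) {ρ : ℝ} (hρ : ρ ∈ Icc (0 : ℝ) 1) :
    ∃ k < J, ρ ∈ Icc (node J k) (node J (k + 1)) := by
  have hJ' : (0 : ℝ) < J := by positivity
  have h0 : 0 ≤ (J : ℝ) * ρ := mul_nonneg hJ'.le hρ.1
  rcases hρ.2.eq_or_lt with rfl | h1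
  · refine ⟨J - 1, by omega, (mem_Icc_node_iff hJ).2 ?_⟩
    rw [Nat.cast_sub hJ]
    constructor <;> simp
  · refine ⟨⌊(J : ℝ) * ρ⌋₊, (Nat.floor_lt h0).2 (by nlinarith), (mem_Icc_node_iff hJ).2
      ⟨Nat.floor_le h0, (Nat.lt_floor_add_one _).le⟩⟩

end Nodes

/-! ### Piecewise linear functions, interpolation and admissible variations -/

section FiniteElements

variable {I : ParamDomain} {J : ℕ}

theorem Vh_add {f g : ℝ → ℝ} (hf : f ∈ Vh I J) (hg : g ∈ Vh I J) :
    (fun ρ => f ρ + g ρ) ∈ Vh I J := by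
  refine ⟨hf.1.add hg.1, fun h => by simp only [hf.2.1 h, hg.2.1 h], fun j hj => ?_⟩
  obtain ⟨a, b, hab⟩ := hf.2.2 j hj
  obtain ⟨a', b', hab'⟩ := hg.2.2 j hj
  exact ⟨a + a', b + b', fun ρ hρ => by simp only [hab ρ hρ, hab' ρ hρ]; ring⟩

theorem Vh_smul (c : ℝ) {f : ℝ → ℝ} (hf : f ∈ Vh I J) : (fun ρ => c * f ρ) ∈ Vh I J := by
  refine ⟨continuousOn_const.mul hf.1, fun h => by simp only [hf.2.1 h], fun j hj => ?_⟩
  obtain ⟨a, b, hab⟩ := hf.2.2 j hj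
  exact ⟨c * a, c * b, fun ρ hρ => by simp only [hab ρ hρ]; ring⟩

theorem VhVec_add {f g : ℝ → Plane} (hf : f ∈ VhVec I J) (hg : g ∈ VhVec I J) :
    f + g ∈ VhVec I J :=
  fun i => Vh_add (hf i) (hg i)

theorem VhVec_smul (c : ℝ) {f : ℝ → Plane} (hf : f ∈ VhVec I J) : c • f ∈ VhVec I J :=
  fun i => Vh_smul c (hf i)

variable (P : BoundaryPartition I)

/-- The admissible variations as a subspace. -/
def bdrySubmodule (J : ℕ) : Submodule ℝ (ℝ → Plane) where
  carrier := VhVecBdry P J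
  add_mem' := by
    rintro f g ⟨⟨hf, h0⟩, h1, h2, hD⟩ ⟨⟨hg, g0⟩, g1, g2, gD⟩
    refine ⟨⟨VhVec_add hf hg, fun p hp => ?_⟩, fun p hp => ?_, fun p hp => ?_, fun p hp => ?_⟩
    · simp [h0 p hp, g0 p hp]
    · simp [h1 p hp, g1 p hp]
    · simp [h2 p hp, g2 p hp]
    · simp [hD p hp, gD p hp]
  zero_mem' := by
    have h : (fun _ => 0 : ℝ → ℝ) ∈ Vh I J :=
      ⟨continuousOn_const, fun _ => rfl, fun _ _ => ⟨0, 0, by simp⟩⟩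
    refine ⟨⟨fun i => by simpa using h, ?_⟩, ?_, ?_, ?_⟩ <;> simp
  smul_mem' := by
    rintro c f ⟨⟨hf, h0⟩, h1, h2, hD⟩
    refine ⟨⟨VhVec_smul c hf, fun p hp => ?_⟩, fun p hp => ?_, fun p hp => ?_, fun p hp => ?_⟩
    · simp [h0 p hp]
    · simp [h1 p hp]
    · simp [h2 p hp]
    · simp [hD p hp]

/-- The piecewise linear interpolant of the nodal values of a function, extended by constants
outside `[0, 1]`. -/
def interp (J : ℕ) : (ℝ → Plane) →ₗ[ℝ] (ℝ → Plane) where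
  toFun f := fun ρ => f (node J 0) + ∑ j ∈ Finset.range J,
    max 0 (min 1 ((J : ℝ) * ρ - j)) • (f (node J (j + 1)) - f (node J j))
  map_add' f g := by
    ext1 ρ
    simp only [Pi.add_apply, add_sub_add_comm, smul_add, Finset.sum_add_distrib]
    exact add_add_add_comm _ _ _ _
  map_smul' c f := by
    ext1 ρ
    simp only [Pi.smul_apply, RingHom.id_apply, smul_add, Finset.smul_sum, ← smul_sub,
      smul_comm c]

theorem interp_apply (f : ℝ → Plane) (ρ : ℝ) : interp J f ρ = f (node J 0) +
    ∑ j ∈ Finset.range J,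
      max 0 (min 1 ((J : ℝ) * ρ - j)) • (f (node J (j + 1)) - f (node J j)) := rfl

theorem interp_congr {f g : ℝ → Plane} (h : ∀ j ≤ J, f (node J j) = g (node J j)) :
    interp J f = interp J g := by
  ext1 ρ
  rw [interp_apply, interp_apply, h 0 (Nat.zero_le _)]
  congr 1
  refine Finset.sum_congr rfl fun j hj => ?_
  have hj' := Finset.mem_range.1 hj
  rw [h j hj'.le, h (j + 1) hj']

/-- On element `k` the clamped coefficient is 1 for every earlier element and 0 for every later one,
so the sum telescopes to the value at node `k` plus one linear term. -/
theorem interp_of_mem_Icc (hJ : 0 < J) (f : ℝ → Plane) {k : ℕ} (hk : k < J) {ρ : ℝ}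
    (hρ : ρ ∈ Icc (node J k) (node J (k + 1))) :
    interp J f ρ =
      f (node J k) + ((J : ℝ) * ρ - k) • (f (node J (k + 1)) - f (node J k)) := by
  obtain ⟨h1, h2⟩ := (mem_Icc_node_iff hJ).1 hρ
  rw [interp_apply, ← Finset.sum_subset (Finset.range_mono (Nat.succ_le_of_lt hk)),
    Finset.sum_range_succ, min_eq_right (by linarith), max_eq_right (by linarith), ← add_assoc]
  · congr 1
    rw [Finset.sum_congr rfl (g := fun j => f (node J (j + 1)) - f (node J j)),
      Finset.sum_range_sub (fun j => f (node J j))]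
    · abel
    · intro j hj
      have hj' : (j : ℝ) + 1 ≤ k := by exact_mod_cast Finset.mem_range.1 hj
      rw [min_eq_left (by linarith), max_eq_right zero_le_one, one_smul]
  · intro j _ hj
    have hj' : (k : ℝ) + 1 ≤ j := by
      exact_mod_cast Nat.succ_le_of_lt (not_le.1 fun h => hj (by simp; omega))
    rw [max_eq_left ((min_le_right _ _).trans (by linarith)), zero_smul]

theorem VhVec_apply (hJ : 0 < J) {f : ℝ → Plane} (hf : f ∈ VhVec I J) {k : ℕ} (hk : k < J) {ρ : ℝ}
    (hρ : ρ ∈ Icc (node J k) (node J (k + 1))) :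
    f ρ = f (node J k) + ((J : ℝ) * ρ - k) • (f (node J (k + 1)) - f (node J k)) := by
  ext i
  obtain ⟨a, b, hab⟩ := (hf i).2.2 k hk
  have hle := (node_lt_node_succ hJ k).le
  have e1 : (J : ℝ) * node J k = k := mul_node hJ k
  have e2 : (J : ℝ) * node J (k + 1) = k + 1 := by rw [mul_node hJ]; push_cast; rfl
  simp only [PiLp.add_apply, PiLp.smul_apply, PiLp.sub_apply, smul_eq_mul, hab ρ hρ,
    hab _ (left_mem_Icc.2 hle), hab _ (right_mem_Icc.2 hle)]
  have hJ' : (J : ℝ) ≠ 0 := by positivity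
  apply mul_left_cancel₀ hJ'
  linear_combination a * (-1 - J * ρ + k) * e1 + a * (J * ρ - k) * (- e2 + 2 * e1)

theorem interp_eq_of_mem_Icc (hJ : 0 < J) {f : ℝ → Plane} (hf : f ∈ VhVec I J) {ρ : ℝ}
    (hρ : ρ ∈ Icc (0 : ℝ) 1) : interp J f ρ = f ρ := by
  obtain ⟨k, hk, h⟩ := exists_mem_Icc_node hJ hρ
  rw [interp_of_mem_Icc hJ f hk h, VhVec_apply hJ hf hk h]

theorem VhVec_congr {f g : ℝ → Plane} (hJ : 0 < J) (hf : f ∈ VhVec I J)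
    (h : ∀ ρ ∈ Icc (0 : ℝ) 1, g ρ = f ρ) : g ∈ VhVec I J := by
  refine fun i => ⟨(hf i).1.congr fun ρ hρ => by simp only [h ρ hρ], fun hI => ?_, fun j hj => ?_⟩
  · simpa only [h 0 (by simp), h 1 (by simp)] using (hf i).2.1 hI
  · obtain ⟨a, b, hab⟩ := (hf i).2.2 j hj
    refine ⟨a, b, fun ρ hρ => ?_⟩
    simp only [← hab ρ hρ]
    rw [h ρ (Icc_subset_Icc (node_mem_Icc hJ hj.le).1 (node_mem_Icc hJ (Nat.succ_le_of_lt hj)).2 hρ)]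

theorem BoundaryPartition.mem_Icc {p : ℝ} (hp : p ∈ P.bdD ∪ P.bd0 ∪ P.bd1 ∪ P.bd2) :
    p ∈ Icc (0 : ℝ) 1 := by
  rw [P.union_eq] at hp
  cases I
  · simp [ParamDomain.boundary] at hp
  · simp only [ParamDomain.boundary, Finset.mem_insert, Finset.mem_singleton] at hp
    rcases hp with rfl | rfl <;> simp

theorem interp_mem_bdrySubmodule (hJ : 0 < J) {f : ℝ → Plane} (hf : f ∈ VhVecBdry P J) :
    interp J f ∈ bdrySubmodule P J := by
  have h := fun ρ hρ => interp_eq_of_mem_Icc (ρ := ρ) hJ hf.1.1 hρ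
  refine ⟨⟨VhVec_congr hJ hf.1.1 h, fun p hp => ?_⟩, fun p hp => ?_, fun p hp => ?_, fun p hp => ?_⟩
  all_goals rw [h p (P.mem_Icc (by simp [hp]))]
  · exact hf.1.2 p hp
  · exact hf.2.1 p hp
  · exact hf.2.2.1 p hp
  · exact hf.2.2.2 p hp

/-- The admissible variations that are determined by their nodal values. -/
def nodalSubmodule (J : ℕ) : Submodule ℝ (ℝ → Plane) :=
  bdrySubmodule P J ⊓ LinearMap.eqLocus (interp J) LinearMap.id

theorem interp_mem_nodalSubmodule (hJ : 0 < J) {f : ℝ → Plane} (hf : f ∈ VhVecBdry P J) :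
    interp J f ∈ nodalSubmodule P J :=
  ⟨interp_mem_bdrySubmodule P hJ hf,
    interp_congr fun _ hj => interp_eq_of_mem_Icc hJ hf.1.1 (node_mem_Icc hJ hj)⟩

theorem eq_zero_of_nodal_eq_zero {f : ℝ → Plane} (hf : f ∈ nodalSubmodule P J)
    (h : ∀ j ≤ J, f (node J j) = 0) : f = 0 := by
  have h1 : interp J f = f := hf.2
  rw [← h1, interp_congr (g := 0) h, map_zero]

/-- Evaluation at the nodes is injective here. It is not on `bdrySubmodule`, whose elements are
arbitrary outside `[0, 1]`. -/
instance (J : ℕ) : FiniteDimensional ℝ (nodalSubmodule P J) := by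
  let T : nodalSubmodule P J →ₗ[ℝ] (Fin (J + 1) → Plane) :=
    LinearMap.pi fun j => LinearMap.proj (node J j) ∘ₗ (nodalSubmodule P J).subtype
  refine Module.Finite.of_injective T ((injective_iff_map_eq_zero T).2 fun f hf => ?_)
  refine Subtype.ext (eq_zero_of_nodal_eq_zero P f.2 fun j hj => ?_)
  exact congrFun hf ⟨j, Nat.lt_succ_of_le hj⟩

theorem deriv_VhVec (hJ : 0 < J) {f : ℝ → Plane} (hf : f ∈ VhVec I J) {k : ℕ} (hk : k < J) {ρ : ℝ}
    (hρ : ρ ∈ Ioo (node J k) (node J (k + 1))) :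
    deriv f ρ = (J : ℝ) • (f (node J (k + 1)) - f (node J k)) := by
  have h : f =ᶠ[nhds ρ] fun ρ =>
      f (node J k) + ((J : ℝ) * ρ - k) • (f (node J (k + 1)) - f (node J k)) := by
    filter_upwards [Ioo_mem_nhds hρ.1 hρ.2] with σ hσ
    exact VhVec_apply hJ hf hk (Ioo_subset_Icc_self hσ)
  rw [h.deriv_eq]
  have h1 : HasDerivAt (fun ρ : ℝ => (J : ℝ) * ρ - k) (J : ℝ) ρ := by
    simpa using ((hasDerivAt_id ρ).const_mul (J : ℝ)).sub_const (k : ℝ)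
  exact ((h1.smul_const _).const_add _).deriv

end FiniteElements


/-! ### Integration and coercivity on one element -/

section Quadrature

variable {J : ℕ}

/-- The local coordinate `s = Jρ - j` maps each element to the unit interval. Only open elements
enter the hypothesis, because derivatives of finite element functions are uncontrolled at the nodes.
-/
theorem integral_eq_sum_elements (hJ : 0 < J) {g : ℝ → ℝ} {p : ℕ → ℝ → ℝ}
    (hp : ∀ j, Continuous (p j))
    (h : ∀ j < J, ∀ ρ ∈ Ioo (node J j) (node J (j + 1)), g ρ = p j ((J : ℝ) * ρ - j)) :
    ∫ ρ in (0 : ℝ)..1, g ρ = (J : ℝ)⁻¹ * ∑ j ∈ Finset.range J, ∫ s in (0 : ℝ)..1, p j s := by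
  have hJ' : (J : ℝ) ≠ 0 := by positivity
  have hc : ∀ j, Continuous fun ρ => p j ((J : ℝ) * ρ - j) := fun j =>
    (hp j).comp (by fun_prop)
  have heq : ∀ j < J, EqOn (fun ρ => p j ((J : ℝ) * ρ - j)) g (uIoo (node J j) (node J (j + 1))) :=
    fun j hj ρ hρ => by
      rw [uIoo_of_le (node_lt_node_succ hJ j).le] at hρ
      exact (h j hj ρ hρ).symm
  have hint : ∀ j < J, IntervalIntegrable g volume (node J j) (node J (j + 1)) := fun j hj =>
    ((hc j).intervalIntegrable _ _).congr_uIoo (heq j hj)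
  have hsum := intervalIntegral.sum_integral_adjacent_intervals hint
  rw [node_zero, node_self hJ] at hsum
  rw [← hsum, Finset.mul_sum]
  refine Finset.sum_congr rfl fun j hj => ?_
  rw [← intervalIntegral.integral_congr_uIoo (heq j (Finset.mem_range.1 hj)),
    intervalIntegral.integral_comp_mul_sub (fun s => p j s) hJ', mul_node hJ, mul_node hJ]
  simp

theorem leftLim_eq_of_elements (hJ : 0 < J) {g q : ℝ → ℝ} (hq : Continuous q) {j : ℕ}
    (h : ∀ ρ ∈ Ioo (node J j) (node J (j + 1)), g ρ = q ((J : ℝ) * ρ - j)) :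
    Function.leftLim g (node J (j + 1)) = q 1 := by
  refine leftLim_eq_of_tendsto ?_
  have h1 : Filter.Tendsto (fun ρ => q ((J : ℝ) * ρ - j)) (nhdsWithin (node J (j + 1))
      (Iio (node J (j + 1)))) (nhds (q ((J : ℝ) * node J (j + 1) - j))) :=
    (Continuous.tendsto (hq.comp (by fun_prop)) _).mono_left nhdsWithin_le_nhds
  rw [mul_node hJ, Nat.cast_add_one, add_sub_cancel_left] at h1
  refine h1.congr' ?_
  filter_upwards [Ioo_mem_nhdsLT (node_lt_node_succ hJ j)] with ρ hρ
  exact (h ρ hρ).symm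

theorem rightLim_eq_of_elements (hJ : 0 < J) {g q : ℝ → ℝ} (hq : Continuous q) {j : ℕ}
    (h : ∀ ρ ∈ Ioo (node J j) (node J (j + 1)), g ρ = q ((J : ℝ) * ρ - j)) :
    Function.rightLim g (node J j) = q 0 := by
  refine rightLim_eq_of_tendsto ?_
  have h1 : Filter.Tendsto (fun ρ => q ((J : ℝ) * ρ - j)) (nhdsWithin (node J j)
      (Ioi (node J j))) (nhds (q ((J : ℝ) * node J j - j))) :=
    (Continuous.tendsto (hq.comp (by fun_prop)) _).mono_left nhdsWithin_le_nhds
  rw [mul_node hJ, sub_self] at h1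
  refine h1.congr' ?_
  filter_upwards [Ioo_mem_nhdsGT (node_lt_node_succ hJ j)] with ρ hρ
  exact (h ρ hρ).symm

theorem integral_cubic (c₀ c₁ c₂ c₃ : ℝ) :
    ∫ s in (0 : ℝ)..1, (c₀ + c₁ * s + c₂ * s ^ 2 + c₃ * s ^ 3) =
      c₀ + c₁ / 2 + c₂ / 3 + c₃ / 4 := by
  have h : ∀ s ∈ uIcc (0 : ℝ) 1, HasDerivAt
      (fun s : ℝ => c₀ * s + c₁ / 2 * s ^ 2 + c₂ / 3 * s ^ 3 + c₃ / 4 * s ^ 4)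
      (c₀ + c₁ * s + c₂ * s ^ 2 + c₃ * s ^ 3) s := fun s _ => by
    have := ((((hasDerivAt_id s).const_mul c₀).add ((hasDerivAt_pow 2 s).const_mul (c₁ / 2))).add
      ((hasDerivAt_pow 3 s).const_mul (c₂ / 3))).add ((hasDerivAt_pow 4 s).const_mul (c₃ / 4))
    exact this.congr_deriv (by push_cast; ring)
  rw [intervalIntegral.integral_eq_sub_of_hasDerivAt h
    (Continuous.intervalIntegrable (by fun_prop) _ _)]
  ring

/-- The contribution of one element of unit length to the inner product of the affine functions
with end values `u`, `u'` and `v`, `v'`, weighted by the affine function with end values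
`a`, `b`. -/
def elementForm (Q : Quadrature) (a b : ℝ) (u u' v v' : Plane) : ℝ :=
  match Q with
  | .exact => ((3 * a + b) * inner ℝ u v + (a + b) * (inner ℝ u v' + inner ℝ u' v) +
      (a + 3 * b) * inner ℝ u' v') / 12
  | .lumped => (a * inner ℝ u v + b * inner ℝ u' v') / 2

theorem elementForm_add_left (Q : Quadrature) (a b : ℝ) (u u' w w' v v' : Plane) :
    elementForm Q a b (u + w) (u' + w') v v' =
      elementForm Q a b u u' v v' + elementForm Q a b w w' v v' := by
  cases Q <;> simp only [elementForm, inner_add_left] <;> ring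

theorem elementForm_smul_left (Q : Quadrature) (a b c : ℝ) (u u' v v' : Plane) :
    elementForm Q a b (c • u) (c • u') v v' = c * elementForm Q a b u u' v v' := by
  cases Q <;> simp only [elementForm, real_inner_smul_left] <;> ring

theorem elementForm_add_right (Q : Quadrature) (a b : ℝ) (u u' v v' w w' : Plane) :
    elementForm Q a b u u' (v + w) (v' + w') =
      elementForm Q a b u u' v v' + elementForm Q a b u u' w w' := by
  cases Q <;> simp only [elementForm, inner_add_right] <;> ring

theorem elementForm_smul_right (Q : Quadrature) (a b c : ℝ) (u u' v v' : Plane) :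
    elementForm Q a b u u' (c • v) (c • v') = c * elementForm Q a b u u' v v' := by
  cases Q <;> simp only [elementForm, real_inner_smul_right] <;> ring

/-- The lower bound is the exact mass form with constant weight `m`. Raising a nodal weight adds a
nonnegative quadratic form, and for constant weight lumping exceeds exact integration by `m ‖u -
u'‖² / 6`. -/
theorem le_elementForm (Q : Quadrature) {a b m : ℝ} (hm : 0 ≤ m) (ha : m ≤ a) (hb : m ≤ b)
    (u u' : Plane) :
    m * ((‖u‖ ^ 2 + inner ℝ u u' + ‖u'‖ ^ 2) / 3) ≤ elementForm Q a b u u' u u' := by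
  have h1 := norm_add_sq_real u u'
  have h2 := norm_sub_sq_real u u'
  have h3 := mul_nonneg (sub_nonneg.2 ha) (sq_nonneg ‖u + u'‖)
  have h4 := mul_nonneg (sub_nonneg.2 hb) (sq_nonneg ‖u + u'‖)
  have h5 := mul_nonneg (sub_nonneg.2 ha) (sq_nonneg ‖u‖)
  have h6 := mul_nonneg (sub_nonneg.2 hb) (sq_nonneg ‖u'‖)
  have h7 := mul_nonneg hm (sq_nonneg ‖u - u'‖)
  have h8 := mul_nonneg hm (sq_nonneg ‖u‖)
  have h9 := mul_nonneg hm (sq_nonneg ‖u'‖)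
  rw [h1] at h3 h4
  rw [h2] at h7
  cases Q <;> simp only [elementForm, real_inner_self_eq_norm_sq, real_inner_comm u u'] <;>
    linarith

/-- Coercivity on one element: the mass term and the stiffness term control the nonlinear term. -/
theorem element_coercive (Q : Quadrature) {a b m dt L : ℝ} (hm : 0 < m) (ha : m ≤ a) (hb : m ≤ b)
    (hdt : 0 < dt) (hdt' : dt < 4 * m ^ 2) (hL : 0 < L) {u u' : Plane} (hu : u ≠ 0 ∨ u' ≠ 0) :
    |(u 0 + u' 0) / 2| * ‖u' - u‖ <
      dt⁻¹ * (L * elementForm Q a b u u' u u') + (a + b) / 2 * L⁻¹ * ‖u' - u‖ ^ 2 := by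
  set r := |(u 0 + u' 0) / 2|
  set p := ‖u' - u‖
  set e := elementForm Q a b u u' u u'
  have he := le_elementForm Q hm.le ha hb u u'
  have h1 := norm_add_sq_real u u'
  have h2 := norm_sub_sq_real u u'
  have hr : r ^ 2 ≤ ‖u + u'‖ ^ 2 / 4 := by
    have h := PiLp.norm_apply_le (u + u') 0
    rw [Real.norm_eq_abs] at h
    have h' := pow_le_pow_left₀ (abs_nonneg _) h 2
    rw [sq_abs, PiLp.add_apply] at h'
    simp only [r, sq_abs]
    linarith
  -- `(‖u‖² + u · u' + ‖u'‖²) / 3` exceeds `‖u + u'‖² / 4` by `‖u - u'‖² / 12`.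
  have her : m * r ^ 2 ≤ e := by
    refine le_trans (mul_le_mul_of_nonneg_left ?_ hm.le) he
    nlinarith [sq_nonneg ‖u - u'‖]
  have he0 : 0 < e := by
    refine lt_of_lt_of_le (mul_pos hm ?_) he
    have : 0 < ‖u‖ ^ 2 + ‖u'‖ ^ 2 := by
      rcases hu with hu | hu
      · have := norm_pos_iff.2 hu
        positivity
      · have := norm_pos_iff.2 hu
        positivity
    nlinarith [sq_nonneg ‖u + u'‖]
  have h3 : (4 * m ^ 2)⁻¹ * (L * e) < dt⁻¹ * (L * e) :=
    mul_lt_mul_of_pos_right (inv_strictAnti₀ hdt hdt') (mul_pos hL he0)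
  have h4 : (4 * m ^ 2)⁻¹ * (L * (m * r ^ 2)) ≤ (4 * m ^ 2)⁻¹ * (L * e) := by gcongr
  have h5 : m * L⁻¹ * p ^ 2 ≤ (a + b) / 2 * L⁻¹ * p ^ 2 := by
    gcongr; linarith
  -- Young's inequality with the weight for which the product `r * p` has coefficient exactly 1;
  -- this is where `4 m²` comes from.
  have h6 : 0 ≤ m * L⁻¹ * (L * r / (2 * m) - p) ^ 2 := by positivity
  have h7 : m * L⁻¹ * (L * r / (2 * m) - p) ^ 2 =
      (4 * m ^ 2)⁻¹ * (L * (m * r ^ 2)) + m * L⁻¹ * p ^ 2 - r * p := by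
    field_simp; ring
  linarith

end Quadrature

/-! ### The terms of the scheme in nodal values -/

section NodalForms

variable {I : ParamDomain} {J : ℕ}

/-- The difference of the values at the end points of an element. -/
def jump (J j : ℕ) : (ℝ → Plane) →ₗ[ℝ] Plane :=
  LinearMap.proj (R := ℝ) (φ := fun _ : ℝ => Plane) (node J (j + 1)) - LinearMap.proj (node J j)

theorem jump_apply (j : ℕ) (f : ℝ → Plane) :
    jump J j f = f (node J (j + 1)) - f (node J j) := rfl

/-- On each element the integrand is one cubic polynomial in the local coordinate, which serves both
the integral and the one-sided limits. The factor `J` in the derivative of `X` cancels the mesh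
size. -/
theorem quadInner_mass (hJ : 0 < J) (Q : Quadrature) {X κ η : ℝ → Plane} (hX : X ∈ VhVec I J)
    (hκ : κ ∈ VhVec I J) (hη : η ∈ VhVec I J) :
    quadInner Q J (fun ρ => X ρ 0 • κ ρ) (fun ρ => ‖deriv X ρ‖ • η ρ) =
      ∑ j ∈ Finset.range J, ‖jump J j X‖ * elementForm Q (X (node J j) 0) (X (node J (j + 1)) 0)
        (κ (node J j)) (κ (node J (j + 1))) (η (node J j)) (η (node J (j + 1))) := by
  have hJ' : (J : ℝ) ≠ 0 := by positivity
  let p : ℕ → ℝ → ℝ := fun j s =>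
    (X (node J j) 0 + s * (X (node J (j + 1)) 0 - X (node J j) 0)) * (J * ‖jump J j X‖) *
      (inner ℝ (κ (node J j)) (η (node J j)) + s * (inner ℝ (κ (node J j)) (jump J j η) +
        inner ℝ (jump J j κ) (η (node J j))) + s ^ 2 * inner ℝ (jump J j κ) (jump J j η))
  have hp : ∀ j, Continuous (p j) := fun j => by fun_prop
  have h : ∀ j < J, ∀ ρ ∈ Ioo (node J j) (node J (j + 1)),
      (inner ℝ (X ρ 0 • κ ρ) (‖deriv X ρ‖ • η ρ) : ℝ) = p j ((J : ℝ) * ρ - j) := by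
    intro j hj ρ hρ
    have hρ' := Ioo_subset_Icc_self hρ
    rw [deriv_VhVec hJ hX hj hρ, VhVec_apply hJ hX hj hρ', VhVec_apply hJ hκ hj hρ',
      VhVec_apply hJ hη hj hρ']
    simp only [← jump_apply, p, norm_smul, real_inner_smul_left, real_inner_smul_right,
      inner_add_left, inner_add_right, PiLp.add_apply, PiLp.smul_apply, smul_eq_mul, Real.norm_natCast]
    simp only [jump_apply, PiLp.sub_apply]
    ring
  cases Q
  · simp only [quadInner, l2Inner]
    rw [integral_eq_sum_elements hJ hp h, Finset.mul_sum]
    refine Finset.sum_congr rfl fun j _ => ?_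
    have h1 : ∀ s, p j s = _ + _ * s + _ * s ^ 2 + _ * s ^ 3 := fun s => by
      set A : ℝ := inner ℝ (κ (node J j)) (η (node J j))
      set B : ℝ := inner ℝ (κ (node J j)) (jump J j η) + inner ℝ (jump J j κ) (η (node J j))
      set C : ℝ := inner ℝ (jump J j κ) (jump J j η)
      set a := X (node J j) 0
      set e := X (node J (j + 1)) 0 - X (node J j) 0
      set K := J * ‖jump J j X‖
      have : p j s = a * K * A + (a * K * B + e * K * A) * s + (a * K * C + e * K * B) * s ^ 2 +
        e * K * C * s ^ 3 := by
        simp only [p]; ring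
      exact this
    simp only [h1, integral_cubic]
    simp only [elementForm, jump_apply, inner_sub_left, inner_sub_right]
    field_simp
    ring
  · simp only [quadInner, lumpedInner]
    rw [mul_assoc, Finset.mul_sum, Finset.mul_sum]
    refine Finset.sum_congr rfl fun j hj => ?_
    have hj' := Finset.mem_range.1 hj
    rw [leftLim_eq_of_elements hJ (hp j) (h j hj'), rightLim_eq_of_elements hJ (hp j) (h j hj')]
    simp only [p, elementForm, jump_apply, inner_sub_left, inner_sub_right]
    field_simp
    ring

theorem l2Inner_length (hJ : 0 < J) {Y η : ℝ → Plane} (hY : Y ∈ VhVec I J)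
    (hη : η ∈ VhVec I J) :
    l2Inner (fun ρ => η ρ 0) (fun ρ => ‖deriv Y ρ‖) = ∑ j ∈ Finset.range J,
      (η (node J j) 0 + η (node J (j + 1)) 0) / 2 * ‖jump J j Y‖ := by
  have hJ' : (J : ℝ) ≠ 0 := by positivity
  let p : ℕ → ℝ → ℝ := fun j s => η (node J j) 0 * (J * ‖jump J j Y‖) +
    (η (node J (j + 1)) 0 - η (node J j) 0) * (J * ‖jump J j Y‖) * s + 0 * s ^ 2 + 0 * s ^ 3
  have hp : ∀ j, Continuous (p j) := fun j => by fun_prop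
  rw [l2Inner, integral_eq_sum_elements hJ hp, Finset.mul_sum]
  · refine Finset.sum_congr rfl fun j _ => ?_
    simp only [p, integral_cubic]
    field_simp
    ring
  · intro j hj ρ hρ
    rw [deriv_VhVec hJ hY hj hρ, VhVec_apply hJ hη hj (Ioo_subset_Icc_self hρ)]
    simp only [p, norm_smul, PiLp.add_apply, PiLp.smul_apply, smul_eq_mul, Real.norm_natCast,
      PiLp.sub_apply, jump_apply, RCLike.inner_apply, conj_trivial]
    ring

theorem l2Inner_stiffness (hJ : 0 < J) {X Y η : ℝ → Plane} (hX : X ∈ VhVec I J)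
    (hY : Y ∈ VhVec I J) (hη : η ∈ VhVec I J) :
    l2Inner (fun ρ => X ρ 0 • deriv Y ρ) (fun ρ => ‖deriv X ρ‖⁻¹ • deriv η ρ) =
      ∑ j ∈ Finset.range J, (X (node J j) 0 + X (node J (j + 1)) 0) / 2 * ‖jump J j X‖⁻¹ *
        inner ℝ (jump J j Y) (jump J j η) := by
  have hJ' : (J : ℝ) ≠ 0 := by positivity
  let c : ℕ → ℝ := fun j => J * ‖jump J j X‖⁻¹ * inner ℝ (jump J j Y) (jump J j η)
  let p : ℕ → ℝ → ℝ := fun j s => X (node J j) 0 * c j +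
    (X (node J (j + 1)) 0 - X (node J j) 0) * c j * s + 0 * s ^ 2 + 0 * s ^ 3
  have hp : ∀ j, Continuous (p j) := fun j => by fun_prop
  rw [l2Inner, integral_eq_sum_elements hJ hp, Finset.mul_sum]
  · refine Finset.sum_congr rfl fun j _ => ?_
    simp only [p, integral_cubic, c]
    rw [inv_mul_eq_iff_eq_mul₀ hJ']
    ring
  · intro j hj ρ hρ
    rw [deriv_VhVec hJ hX hj hρ, deriv_VhVec hJ hY hj hρ, deriv_VhVec hJ hη hj hρ,
      VhVec_apply hJ hX hj (Ioo_subset_Icc_self hρ)]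
    simp only [← jump_apply, p, c, norm_smul, real_inner_smul_left, real_inner_smul_right,
      PiLp.add_apply, PiLp.smul_apply, smul_eq_mul, Real.norm_natCast, mul_inv]
    simp only [jump_apply, PiLp.sub_apply]
    field_simp
    ring

/-- The derivative is constant on an open element, so a zero jump would make it vanish on a set of
positive measure. -/
theorem jump_ne_zero (hJ : 0 < J) {X : ℝ → Plane} (hX : X ∈ VhVec I J)
    (h : ∀ᵐ ρ ∂(volume.restrict (Ioo (0 : ℝ) 1)), 0 < ‖deriv X ρ‖) {j : ℕ} (hj : j < J) :
    jump J j X ≠ 0 := by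
  intro h0
  have hsub : Ioo (node J j) (node J (j + 1)) ⊆ Ioo 0 1 :=
    Ioo_subset_Ioo (node_mem_Icc hJ hj.le).1 (node_mem_Icc hJ (Nat.succ_le_of_lt hj)).2
  have h1 := (ae_restrict_iff' measurableSet_Ioo).1 (ae_restrict_of_ae_restrict_of_subset hsub h)
  have h2 : volume (Ioo (node J j) (node J (j + 1))) = 0 := by
    refine measure_mono_null (fun ρ hρ => ?_) (ae_iff.1 h1)
    simp only [mem_ofPred_eq, Classical.not_imp]
    refine ⟨hρ, ?_⟩
    rw [deriv_VhVec hJ hX hj hρ, ← jump_apply, h0]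
    simp
  rw [Real.volume_Ioo, ENNReal.ofReal_eq_zero] at h2
  linarith [node_lt_node_succ hJ j]

end NodalForms


/-! ### The reduced problem and its solution -/

section Scheme

variable {I : ParamDomain} {J : ℕ}

/-- Mass, stiffness and contact energy terms of the scheme as a bilinear form. -/
def schemeForm (Q : Quadrature) (P : BoundaryPartition I) (J : ℕ) (c : ℝ → ℝ) (dt : ℝ)
    (X : ℝ → Plane) : (ℝ → Plane) →ₗ[ℝ] (ℝ → Plane) →ₗ[ℝ] ℝ :=
  LinearMap.mk₂ ℝ (fun u v =>
    (∑ j ∈ Finset.range J, (dt⁻¹ * (‖jump J j X‖ * elementForm Q (X (node J j) 0)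
        (X (node J (j + 1)) 0) (u (node J j)) (u (node J (j + 1))) (v (node J j))
        (v (node J (j + 1)))) +
      (X (node J j) 0 + X (node J (j + 1)) 0) / 2 * ‖jump J j X‖⁻¹ *
        inner ℝ (jump J j u) (jump J j v))) + ∑ p ∈ P.bd2, posPart (c p) * u p 0 * v p 0)
    (fun u w v => by
      rw [add_add_add_comm, ← Finset.sum_add_distrib, ← Finset.sum_add_distrib]
      congr 1 <;> refine Finset.sum_congr rfl fun j _ => ?_
      · simp only [Pi.add_apply, elementForm_add_left, map_add, inner_add_left]; ring
      · simp only [Pi.add_apply, PiLp.add_apply]; ring)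
    (fun a u v => by
      rw [smul_eq_mul, mul_add, Finset.mul_sum, Finset.mul_sum]
      congr 1 <;> refine Finset.sum_congr rfl fun j _ => ?_
      · simp only [Pi.smul_apply, elementForm_smul_left, map_smul, real_inner_smul_left]; ring
      · simp only [Pi.smul_apply, PiLp.smul_apply, smul_eq_mul]; ring)
    (fun u v w => by
      rw [add_add_add_comm, ← Finset.sum_add_distrib, ← Finset.sum_add_distrib]
      congr 1 <;> refine Finset.sum_congr rfl fun j _ => ?_
      · simp only [Pi.add_apply, elementForm_add_right, map_add, inner_add_right]; ring
      · simp only [Pi.add_apply, PiLp.add_apply]; ring)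
    (fun a u v => by
      rw [smul_eq_mul, mul_add, Finset.mul_sum, Finset.mul_sum]
      congr 1 <;> refine Finset.sum_congr rfl fun j _ => ?_
      · simp only [Pi.smul_apply, elementForm_smul_right, map_smul, real_inner_smul_right]; ring
      · simp only [Pi.smul_apply, PiLp.smul_apply, smul_eq_mul]; ring)

/-- The terms of the scheme that do not depend on the unknown. -/
def schemeLoad (P : BoundaryPartition I) (J : ℕ) (c : ℝ → ℝ) (X : ℝ → Plane) :
    (ℝ → Plane) →ₗ[ℝ] ℝ where
  toFun v := (∑ j ∈ Finset.range J, (X (node J j) 0 + X (node J (j + 1)) 0) / 2 *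
      ‖jump J j X‖⁻¹ * inner ℝ (jump J j X) (jump J j v)) +
    (∑ p ∈ P.bd1, c p * X p 0 * v p 1 +
      ∑ p ∈ P.bd2, (posPart (c p) + negPart (c p)) * X p 0 * v p 0)
  map_add' v w := by
    rw [add_add_add_comm, add_add_add_comm (∑ p ∈ P.bd1, _), ← Finset.sum_add_distrib,
      ← Finset.sum_add_distrib, ← Finset.sum_add_distrib]
    congr 1
    · simp only [map_add, inner_add_right, mul_add]
    · simp only [Pi.add_apply, PiLp.add_apply, mul_add]
  map_smul' a v := by
    simp only [RingHom.id_apply, smul_eq_mul, mul_add, Finset.mul_sum]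
    congr 1
    · refine Finset.sum_congr rfl fun j _ => ?_
      rw [map_smul, real_inner_smul_right]; ring
    · congr 1 <;> refine Finset.sum_congr rfl fun p _ => ?_ <;>
        simp only [Pi.smul_apply, PiLp.smul_apply, smul_eq_mul] <;> ring

/-- The mean value of the first component over an element. -/
def meanFst (J j : ℕ) : (ℝ → Plane) →ₗ[ℝ] ℝ where
  toFun v := (v (node J j) 0 + v (node J (j + 1)) 0) / 2
  map_add' v w := by simp only [Pi.add_apply, PiLp.add_apply]; ring
  map_smul' a v := by
    simp only [Pi.smul_apply, PiLp.smul_apply, smul_eq_mul, RingHom.id_apply]; ring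

theorem schemeForm_coercive (hJ : 0 < J) (Q : Quadrature) (P : BoundaryPartition I) (c : ℝ → ℝ)
    {dt m : ℝ} (hdt : 0 < dt) (hm : 0 < m) (hdt' : dt < 4 * m ^ 2) {X : ℝ → Plane}
    (hX : ∀ j ≤ J, m ≤ X (node J j) 0) (hjump : ∀ j < J, jump J j X ≠ 0) {w : ℝ → Plane}
    (hw : ∃ j ≤ J, w (node J j) ≠ 0) :
    ∑ j ∈ Finset.range J, |meanFst J j w| * ‖jump J j w‖ < schemeForm Q P J c dt X w w := by
  -- Only the nonnegative part of the contact density is treated implicitly, so this term helps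
  -- coercivity.
  have hbd : 0 ≤ ∑ p ∈ P.bd2, posPart (c p) * w p 0 * w p 0 :=
    Finset.sum_nonneg fun p _ => by
      rw [mul_assoc]
      exact mul_nonneg (le_max_right _ _) (mul_self_nonneg _)
  rw [schemeForm, LinearMap.mk₂_apply]
  refine lt_of_lt_of_le ?_ (le_add_of_nonneg_right hbd)
  have hstrict : ∀ j < J, w (node J j) ≠ 0 ∨ w (node J (j + 1)) ≠ 0 →
      |meanFst J j w| * ‖jump J j w‖ < _ := fun j hj h =>
    element_coercive Q hm (hX j hj.le) (hX (j + 1) hj) hdt hdt' (norm_pos_iff.2 (hjump j hj)) h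
  simp only [real_inner_self_eq_norm_sq]
  refine Finset.sum_lt_sum (fun j hj => ?_) ?_
  · by_cases h : w (node J j) ≠ 0 ∨ w (node J (j + 1)) ≠ 0
    · exact (hstrict j (Finset.mem_range.1 hj) h).le
    · push Not at h
      have h0 : jump J j w = 0 := by rw [jump_apply, h.1, h.2, sub_zero]
      rw [h0, h.1, h.2]
      cases Q <;> simp [elementForm]
  · obtain ⟨j, hj, h⟩ := hw
    rcases hj.lt_or_eq with hj | rfl
    · exact ⟨j, Finset.mem_range.2 hj, hstrict j hj (Or.inl h)⟩
    -- The last node is the left end of no element; it is the right end of element `J - 1`.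
    · have e : j - 1 + 1 = j := by omega
      exact ⟨j - 1, Finset.mem_range.2 (by omega),
        hstrict (j - 1) (by omega) (Or.inr (by rwa [e]))⟩

/-- The residual of the scheme after elimination of the discrete curvature, in terms of nodal and
boundary values. -/
def residual (Q : Quadrature) (P : BoundaryPartition I) (J : ℕ) (c : ℝ → ℝ) (dt : ℝ)
    (X u v : ℝ → Plane) : ℝ :=
  schemeForm Q P J c dt X u v +
    ∑ j ∈ Finset.range J, meanFst J j v * ‖jump J j X + jump J j u‖ + schemeLoad P J c X v

theorem residual_congr (Q : Quadrature) (P : BoundaryPartition I) (c : ℝ → ℝ) (dt : ℝ)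
    (X u : ℝ → Plane) {v w : ℝ → Plane} (hJ : 0 < J) (h : ∀ ρ ∈ Icc (0 : ℝ) 1, v ρ = w ρ) :
    residual Q P J c dt X u v = residual Q P J c dt X u w := by
  have h0 : ∀ j ∈ Finset.range J, v (node J j) = w (node J j) := fun j hj =>
    h _ (node_mem_Icc hJ (Finset.mem_range.1 hj).le)
  have h1 : ∀ j ∈ Finset.range J, v (node J (j + 1)) = w (node J (j + 1)) := fun j hj =>
    h _ (node_mem_Icc hJ (Nat.succ_le_of_lt (Finset.mem_range.1 hj)))
  have h2 : ∀ p ∈ P.bd1, v p = w p := fun p hp => h p (P.mem_Icc (by simp [hp]))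
  have h3 : ∀ p ∈ P.bd2, v p = w p := fun p hp => h p (P.mem_Icc (by simp [hp]))
  simp only [residual, schemeForm, LinearMap.mk₂_apply, schemeLoad, meanFst, LinearMap.coe_mk,
    AddHom.coe_mk, jump_apply]
  congr 1; congr 1; congr 1
  · exact Finset.sum_congr rfl fun j hj => by rw [h0 j hj, h1 j hj]
  · exact Finset.sum_congr rfl fun p hp => by rw [h3 p hp]
  · exact Finset.sum_congr rfl fun j hj => by rw [h0 j hj, h1 j hj]
  congr 1; swap; congr 1
  · exact Finset.sum_congr rfl fun p hp => by rw [h2 p hp]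
  · exact Finset.sum_congr rfl fun p hp => by rw [h3 p hp]
  · exact Finset.sum_congr rfl fun j hj => by rw [h0 j hj, h1 j hj]

/-- The equation is solved on `nodalSubmodule`. A general test function is replaced by its
interpolant, which leaves the residual unchanged since that depends only on values in `[0, 1]`. -/
theorem exists_residual_eq_zero (hJ : 0 < J) (Q : Quadrature) (P : BoundaryPartition I)
    (c : ℝ → ℝ) {dt m : ℝ} (hdt : 0 < dt) (hm : 0 < m) (hdt' : dt < 4 * m ^ 2) {X : ℝ → Plane}
    (hX : ∀ j ≤ J, m ≤ X (node J j) 0) (hjump : ∀ j < J, jump J j X ≠ 0) :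
    ∃ u ∈ VhVecBdry P J, ∀ η ∈ VhVecBdry P J, residual Q P J c dt X u η = 0 := by
  let S := nodalSubmodule P J
  obtain ⟨u, hu⟩ := exists_bilin_add_sum_norm_eq_zero (E := S) (Finset.range J)
    ((schemeForm Q P J c dt X).compl₁₂ S.subtype S.subtype)
    (fun j => meanFst J j ∘ₗ S.subtype) (fun j => jump J j ∘ₗ S.subtype) (fun j => jump J j X)
    (schemeLoad P J c X ∘ₗ S.subtype) (fun w hw => by
      refine schemeForm_coercive hJ Q P c hdt hm hdt' hX hjump ?_
      by_contra! h
      exact hw (Subtype.ext (eq_zero_of_nodal_eq_zero P w.2 h)))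
  refine ⟨u, u.2.1, fun η hη => ?_⟩
  rw [← residual_congr Q P c dt X u hJ fun ρ hρ => interp_eq_of_mem_Icc hJ hη.1.1 hρ]
  exact hu ⟨interp J η, interp_mem_nodalSubmodule P hJ hη⟩

theorem WhVec_eq_of_bd0_eq_empty (Q : Quadrature) (P : BoundaryPartition I) (hP : P.bd0 = ∅) :
    WhVec Q P J = VhVec I J := by
  cases Q
  · rfl
  · ext χ
    simp [WhVec, WhAxis, VhVec, hP]

theorem isSolutionDStar_of_residual (hJ : 0 < J) (Q : Quadrature) (P : BoundaryPartition I)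
    (hP : P.bd0 = ∅) (c : ℝ → ℝ) {dt : ℝ} {X u : ℝ → Plane} (hX : X ∈ VhVec I J)
    (hu : u ∈ VhVecBdry P J) (h : ∀ η ∈ VhVecBdry P J, residual Q P J c dt X u η = 0) :
    IsSolutionDStar Q P J c dt X u (dt⁻¹ • u) := by
  have hu' : u ∈ VhVec I J := hu.1.1
  refine ⟨hu, ?_, fun χ _ => ?_, fun η hη => ?_⟩
  · rw [WhVec_eq_of_bd0_eq_empty Q P hP]
    exact VhVec_smul _ hu'
  · simp only [Pi.add_apply, add_sub_cancel_left, Pi.smul_apply]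
  · have hη' : η ∈ VhVec I J := hη.1.1
    rw [quadInner_mass hJ Q hX (VhVec_smul _ hu') hη', l2Inner_length hJ (VhVec_add hX hu') hη',
      l2Inner_stiffness hJ hX (VhVec_add hX hu') hη']
    have h' := h η hη
    simp only [residual, schemeForm, LinearMap.mk₂_apply, schemeLoad, meanFst, LinearMap.coe_mk,
      AddHom.coe_mk, Finset.sum_add_distrib, add_mul] at h'
    simp only [Pi.smul_apply, elementForm_smul_left, map_add, inner_add_left, mul_add,
      Finset.sum_add_distrib, Pi.add_apply, PiLp.add_apply, add_mul, mul_left_comm _ dt⁻¹]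
    linarith

end Scheme

end AxiMCF

end

theorem theorem4p5 (I : AxiMCF.ParamDomain) (P : AxiMCF.BoundaryPartition I)
    (hP : P.bd0 = ∅) (J : ℕ) (hJ : 3 ≤ J) (c : ℝ → ℝ) (dt : ℝ) (hdt : 0 < dt)
    (X : ℝ → AxiMCF.Plane) (hX : X ∈ AxiMCF.VhVec I J) (hA : AxiMCF.AssumptionA P X)
    (μ : ℝ) (hμ : IsLeast ((fun ρ => (X ρ 0) ^ 2) '' Set.Icc (0 : ℝ) 1) μ)
    (hsmall : dt < 3 * μ) (Q : AxiMCF.Quadrature) :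
    ∃ δX κ : ℝ → AxiMCF.Plane, AxiMCF.IsSolutionDStar Q P J c dt X δX κ := by
  have hJ0 : 0 < J := by omega
  have hpos : ∀ ρ ∈ Icc (0 : ℝ) 1, 0 < X ρ 0 := fun ρ hρ => hA.2 ρ hρ (by simp [hP])
  obtain ⟨⟨ρ₀, hρ₀, rfl⟩, hmin⟩ := hμ
  have hle : ∀ ρ ∈ Icc (0 : ℝ) 1, X ρ₀ 0 ≤ X ρ 0 := fun ρ hρ =>
    le_of_sq_le_sq (hmin ⟨ρ, hρ, rfl⟩) (hpos ρ hρ).le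
  have hm := hpos ρ₀ hρ₀
  -- Here `m = X ρ₀ 0`, the minimum of `X · e₁`; positivity of `m²` gives `3 m² < 4 m²`.
  obtain ⟨u, hu, h⟩ := AxiMCF.exists_residual_eq_zero hJ0 Q P c hdt hm
    (by have := pow_pos hm 2; linarith) (fun j hj => hle _ (AxiMCF.node_mem_Icc hJ0 hj))
    (fun j hj => AxiMCF.jump_ne_zero hJ0 hX hA.1 hj)
  exact ⟨u, _, AxiMCF.isSolutionDStar_of_residual hJ0 Q P hP c hX hu h⟩
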